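/- Let $\mathcal C$ be a small additive category; all that is required of it is that its Hom-sets are abelian groups and that composition is biadditive (finite biproducts need not exist). A $\mathcal C$-module is an additive functor $\mathcal C^{\mathrm{op}}\to\mathrm{Ab}$, and its cardinality is $|M|=\sum_{X\in\mathcal S}|M(X)|$, where $\mathcal S$ is a skeleton of $\mathcal C$. Let $\mathcal A$ be a set of $\mathcal C$-modules, and let $\sigma$ be the purity projectively generated by $\mathcal A$: a submodule $K\le M$ is called $\sigma$-pure in $M$ if for every $A\in\mathcal A$ the sequence $$0\to\operatorname{Hom}(A,K)\to\operatorname{Hom}(A,M)\to\operatorname{Hom}(A,M/K)\to 0$$ is exact. Then for every cardinal $\lambda$ there is a cardinal $\kappa$ such that for every $\mathcal C$-module $M$ and every submodule $L\le M$ with $|M|\ge\kappa$ and $|M/L|\le\lambda$, the submodule $L$ contains a nonzero submodule that is $\sigma$-pure in $M$. -/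

import Mathlib

open CategoryTheory Opposite

universe u

/-- The category `Mod C` of (right) `C`-modules: additive functors `Cᵒᵖ ⥤ Ab`. -/
abbrev CMod (C : Type u) [SmallCategory C] [Preadditive C] :=
  Cᵒᵖ ⥤+ AddCommGrpCat.{u}

namespace CMod

variable {C : Type u} [SmallCategory C] [Preadditive C]

/-- The cardinality `|M| = ∑_{X ∈ S} |M(X)|`, where `S` is a skeleton of `C`. -/
noncomputable def card (M : CMod C) : Cardinal.{u} :=
  Cardinal.sum fun X : Skeleton C =>
    Cardinal.mk (M.obj.obj (op ((fromSkeleton C).obj X)))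

/-- A submodule of a `C`-module: a subgroup of every `M(X)`, stable under the action of
the morphisms of `C`. -/
@[ext]
structure Sub (M : CMod C) where
  carrier : (X : Cᵒᵖ) → AddSubgroup (M.obj.obj X)
  map_mem : ∀ {X Y : Cᵒᵖ} (f : X ⟶ Y) (x : M.obj.obj X),
    x ∈ carrier X → (M.obj.map f).hom x ∈ carrier Y

namespace Sub

variable {M : CMod C}

instance : LE (Sub M) where
  le K L := ∀ X, K.carrier X ≤ L.carrier X

/-- The zero submodule. -/
instance : Bot (Sub M) where
  bot :=
    { carrier := fun _ => ⊥
      map_mem := fun f x hx => by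
        rw [AddSubgroup.mem_bot] at hx ⊢
        rw [hx, map_zero] }

/-- A submodule, as a `C`-module. -/
def toCMod (L : Sub M) : CMod C where
  obj :=
    { obj := fun X => AddCommGrpCat.of (L.carrier X)
      map := fun {X Y} f => AddCommGrpCat.ofHom
        (((M.obj.map f).hom.comp (L.carrier X).subtype).codRestrict (L.carrier Y)
          fun x => L.map_mem f x x.2)
      map_id := fun X => by
        ext x
        simp
      map_comp := fun f g => by
        ext x
        exact congrArg (fun h => h.hom x.1) (M.obj.map_comp f g) }
  property :=
    { map_add := fun {X Y f g} => by
        ext x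
        exact congrArg (fun h => h.hom x.1) (M.obj.map_add (f := f) (g := g)) }

/-- The quotient `C`-module `M/L`, formed objectwise. -/
def quotient (L : Sub M) : CMod C where
  obj :=
    { obj := fun X => AddCommGrpCat.of (M.obj.obj X ⧸ L.carrier X)
      map := fun {X Y} f => AddCommGrpCat.ofHom
        (QuotientAddGroup.map (L.carrier X) (L.carrier Y) (M.obj.map f).hom
          fun x hx => L.map_mem f x hx)
      map_id := fun X => by
        ext x
        exact congrArg (fun h => (h.hom x : M.obj.obj X ⧸ L.carrier X)) (M.obj.map_id X)
      map_comp := fun {X Y Z} f g => by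
        ext x
        exact congrArg (fun h => (h.hom x : M.obj.obj Z ⧸ L.carrier Z)) (M.obj.map_comp f g) }
  property :=
    { map_add := fun {X Y f g} => by
        ext x
        exact congrArg (fun h => (h.hom x : M.obj.obj Y ⧸ L.carrier Y))
          (M.obj.map_add (f := f) (g := g)) }

/-- The inclusion `L ⟶ M`. -/
def incl (L : Sub M) : L.toCMod ⟶ M where
  hom :=
    { app := fun X => AddCommGrpCat.ofHom (L.carrier X).subtype
      naturality := fun X Y f => by
        ext x
        rfl }

/-- The projection `M ⟶ M/L`. -/
def proj (L : Sub M) : M ⟶ L.quotient where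
  hom :=
    { app := fun X => AddCommGrpCat.ofHom (QuotientAddGroup.mk' (L.carrier X))
      naturality := fun X Y f => by
        ext x
        rfl }

/-- The sequence `0 ⟶ L ⟶ M ⟶ M/L ⟶ 0`. -/
def seq (L : Sub M) : ShortComplex (CMod C) where
  f := L.incl
  g := L.proj
  zero := by
    ext X x
    exact (QuotientAddGroup.eq_zero_iff _).2 x.2

/-- `L` is `σ_𝒜`-pure in `M`, where `σ_𝒜` is the purity projectively generated by `𝒜`:
for every `A ∈ 𝒜` the functor `Hom(A, -)` takes `0 ⟶ L ⟶ M ⟶ M/L ⟶ 0` to a short exact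
sequence of abelian groups. -/
def IsPure (𝒜 : Set (CMod C)) (L : Sub M) : Prop :=
  ∀ A ∈ 𝒜, (L.seq.map (preadditiveCoyoneda.obj (op A))).ShortExact

end Sub

end CMod

namespace CMod

variable {C : Type u} [SmallCategory C] [Preadditive C]

/-! Lift `A ⟶ M/K` to a family of maps `A(X) → M(X)`. Its defect lies in `K`, and the lift can be
corrected to a morphism if some `K`-valued family has the same defect. To get this for a small `K`,
make solving such systems an operation: `exists_coherent_solution` chooses `V` with `V d - V d'`
solving `d - d'` whenever that is solvable. For terms closed under `V` and the module operations,
the differences `t(i) - t(j)` form a pure submodule for any `i`, `j` (`Term.isPure_diffSub`). The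
terms do not depend on `M`, so for large `M` the pigeonhole principle gives `i ≠ j` with `t(i) ≡
t(j)` modulo `L` for every term `t`. -/

/-- Right-hand sides for the defining relations of `A`, with values in the family `T`: the relations
express additivity of a family of maps `A(X) → T(X)` and its naturality. -/
structure Defect (A : CMod C) (T : Cᵒᵖ → Type u) where
  add : ∀ X : Cᵒᵖ, A.obj.obj X → A.obj.obj X → T X
  map : ∀ X Y : Cᵒᵖ, (X ⟶ Y) → A.obj.obj X → T Y

/-- A family of maps `v` whose failure to be a morphism `A ⟶ M` is the difference `d - d'`. -/
structure IsSolution {A M : CMod C} (d d' : Defect A fun X => M.obj.obj X)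
    (v : ∀ X, A.obj.obj X → M.obj.obj X) : Prop where
  add : ∀ X a b, v X (a + b) - v X a - v X b = d.add X a b - d'.add X a b
  map : ∀ X Y (f : X ⟶ Y) a,
    v Y ((A.obj.map f).hom a) - (M.obj.map f).hom (v X a) = d.map X Y f a - d'.map X Y f a

namespace IsSolution

variable {A M : CMod C} {d d' d'' : Defect A fun X => M.obj.obj X}
  {v w : ∀ X, A.obj.obj X → M.obj.obj X}

theorem refl (d : Defect A fun X => M.obj.obj X) : IsSolution d d 0 where
  add X a b := by simp
  map X Y f a := by simp

theorem sub (hv : IsSolution d d'' v) (hw : IsSolution d' d'' w) : IsSolution d d' (v - w) where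
  add X a b := by
    rw [← sub_sub_sub_cancel_right (d.add X a b) _ (d''.add X a b), ← hv.add X a b,
      ← hw.add X a b]
    simp only [Pi.sub_apply]
    abel
  map X Y f a := by
    rw [← sub_sub_sub_cancel_right (d.map X Y f a) _ (d''.map X Y f a), ← hv.map X Y f a,
      ← hw.map X Y f a]
    simp only [Pi.sub_apply, map_sub]
    abel

end IsSolution

/-- `d - d'` is the defect of some family of maps `A(X) → M(X)`. -/
def solvable (A M : CMod C) : Setoid (Defect A fun X => M.obj.obj X) where
  r d d' := ∃ v, IsSolution d d' v
  iseqv :=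
    { refl := fun d => ⟨0, .refl d⟩
      symm := fun ⟨_, h⟩ => ⟨_, (IsSolution.refl _).sub h⟩
      trans := fun ⟨_, h⟩ ⟨_, h'⟩ => ⟨_, h.sub ((IsSolution.refl _).sub h')⟩ }

/-- Solutions can be chosen coherently: a single function `V` of `d` such that `V d - V d'` solves
`d - d'` whenever this is possible at all. -/
theorem exists_coherent_solution (A M : CMod C) :
    ∃ V : (Defect A fun X => M.obj.obj X) → ∀ X, A.obj.obj X → M.obj.obj X,
      ∀ d d', (∃ v, IsSolution d d' v) → IsSolution d d' (V d - V d') := by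
  -- `V d` solves `d` minus the representative of its class; equivalent right-hand sides share the
  -- representative, which cancels in `V d - V d'`.
  choose V hV using fun d : Defect A fun X => M.obj.obj X =>
    (solvable A M).symm' (Quotient.mk_out (s := solvable A M) d)
  refine ⟨V, fun d d' h => (hV d).sub ?_⟩
  have : Quotient.mk (solvable A M) d = Quotient.mk _ d' := Quotient.sound h
  rw [this]
  exact hV d'

/-- The chosen coherent solution. -/
noncomputable def coherentSolution {A M : CMod C} (d : Defect A fun X => M.obj.obj X) :
    ∀ X, A.obj.obj X → M.obj.obj X :=
  (exists_coherent_solution A M).choose d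

theorem isSolution_coherentSolution_sub {A M : CMod C} {d d' : Defect A fun X => M.obj.obj X}
    {v : ∀ X, A.obj.obj X → M.obj.obj X} (h : IsSolution d d' v) :
    IsSolution d d' (coherentSolution d - coherentSolution d') :=
  (exists_coherent_solution A M).choose_spec d d' ⟨v, h⟩

/-- Terms in one variable of type `X₀`, built from the module operations and from symbols for
coherent solutions of systems of shape `F k`. -/
inductive Term {ι : Type u} (F : ι → CMod C) (X₀ : Cᵒᵖ) : Cᵒᵖ → Type u
  | var : Term F X₀ X₀
  | zero (X : Cᵒᵖ) : Term F X₀ X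
  | add {X : Cᵒᵖ} (s t : Term F X₀ X) : Term F X₀ X
  | neg {X : Cᵒᵖ} (t : Term F X₀ X) : Term F X₀ X
  | map {X Y : Cᵒᵖ} (f : X ⟶ Y) (t : Term F X₀ X) : Term F X₀ Y
  | sol (k : ι) (p : ∀ X : Cᵒᵖ, (F k).obj.obj X → (F k).obj.obj X → Term F X₀ X)
      (q : ∀ X Y : Cᵒᵖ, (X ⟶ Y) → (F k).obj.obj X → Term F X₀ Y)
      {X : Cᵒᵖ} (a : (F k).obj.obj X) : Term F X₀ X

namespace Term

variable {ι : Type u} {F : ι → CMod C} {X₀ : Cᵒᵖ}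

/-- The value of a term in `M`. -/
noncomputable def eval (M : CMod C) (i : M.obj.obj X₀) : ∀ {X : Cᵒᵖ}, Term F X₀ X → M.obj.obj X
  | _, var => i
  | _, zero _ => 0
  | _, add s t => s.eval M i + t.eval M i
  | _, neg t => -t.eval M i
  | _, map f t => (M.obj.map f).hom (t.eval M i)
  | _, sol k p q a => coherentSolution (A := F k)
      ⟨fun X a b => (p X a b).eval M i, fun X Y f a => (q X Y f a).eval M i⟩ _ a

/-- The submodule of all differences `t(i) - t(j)`. -/
noncomputable def diffSub (F : ι → CMod C) {M : CMod C} (i j : M.obj.obj X₀) : Sub M where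
  carrier X :=
    { carrier := {x | ∃ t : Term F X₀ X, t.eval M i - t.eval M j = x}
      zero_mem' := ⟨zero X, by simp [eval]⟩
      add_mem' := by
        rintro _ _ ⟨s, rfl⟩ ⟨t, rfl⟩
        exact ⟨s.add t, by simp only [eval]; abel⟩
      neg_mem' := by
        rintro _ ⟨t, rfl⟩
        exact ⟨t.neg, by simp only [eval]; abel⟩ }
  map_mem := by
    rintro X Y f _ ⟨t, rfl⟩
    exact ⟨t.map f, by simp only [eval, map_sub]⟩

theorem mem_diffSub {M : CMod C} {i j : M.obj.obj X₀} {X : Cᵒᵖ} {x : M.obj.obj X} :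
    x ∈ (diffSub F i j).carrier X ↔ ∃ t : Term F X₀ X, t.eval M i - t.eval M j = x :=
  Iff.rfl

theorem diffSub_ne_bot {M : CMod C} {i j : M.obj.obj X₀} (h : i ≠ j) : diffSub F i j ≠ ⊥ := by
  intro hb
  have : i - j ∈ (diffSub F i j).carrier X₀ := ⟨var, by simp only [eval]⟩
  rw [hb] at this
  exact h (sub_eq_zero.1 (AddSubgroup.mem_bot.1 this))

/-- A family of maps `A(X) → M(X)` which is a morphism modulo `diffSub F i j` can be corrected by
elements of `diffSub F i j` to a morphism `A ⟶ M`. -/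
theorem exists_correction {M : CMod C} (i j : M.obj.obj X₀) (k : ι)
    (m : ∀ X, (F k).obj.obj X → M.obj.obj X)
    (hadd : ∀ X a b, m X (a + b) - m X a - m X b ∈ (diffSub F i j).carrier X)
    (hmap : ∀ X Y (f : X ⟶ Y) a, m Y (((F k).obj.map f).hom a) - (M.obj.map f).hom (m X a) ∈
      (diffSub F i j).carrier Y) :
    ∃ g : F k ⟶ M, ∀ X a, m X a - (g.hom.app X).hom a ∈ (diffSub F i j).carrier X := by
  simp only [mem_diffSub] at hadd hmap
  choose p hp using hadd
  choose q hq using hmap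
  have hm : IsSolution (A := F k)
      ⟨fun X a b => (p X a b).eval M i, fun X Y f a => (q X Y f a).eval M i⟩
      ⟨fun X a b => (p X a b).eval M j, fun X Y f a => (q X Y f a).eval M j⟩ m :=
    ⟨fun X a b => (hp X a b).symm, fun X Y f a => (hq X Y f a).symm⟩
  -- Solvability is witnessed by `m` itself; the coherent solution has the same defect but, through
  -- `sol`, values in `diffSub F i j`. Hence `m - y` is a morphism.
  have hy := isSolution_coherentSolution_sub hm
  have hmem : ∀ X a, (coherentSolution (A := F k)
      ⟨fun X a b => (p X a b).eval M i, fun X Y f a => (q X Y f a).eval M i⟩ -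
      coherentSolution (A := F k)
      ⟨fun X a b => (p X a b).eval M j, fun X Y f a => (q X Y f a).eval M j⟩) X a ∈
      (diffSub F i j).carrier X :=
    fun X a => ⟨sol k p q a, by simp only [eval, Pi.sub_apply]⟩
  generalize coherentSolution (A := F k) _ - coherentSolution (A := F k) _ = y at hy hmem
  have hg : ∀ X a b, (m - y) X (a + b) = (m - y) X a + (m - y) X b := fun X a b => by
    have := (hm.add X a b).trans (hy.add X a b).symm
    simp only [Pi.sub_apply]
    rw [sub_sub, sub_sub, sub_eq_sub_iff_sub_eq_sub] at this
    rw [this]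
    abel
  have hg' : ∀ X Y (f : X ⟶ Y) a,
      (m - y) Y (((F k).obj.map f).hom a) = (M.obj.map f).hom ((m - y) X a) := fun X Y f a => by
    have := (hm.map X Y f a).trans (hy.map X Y f a).symm
    simp only [Pi.sub_apply, map_sub]
    rwa [sub_eq_sub_iff_sub_eq_sub] at this
  refine ⟨⟨{ app := fun X => AddCommGrpCat.ofHom (AddMonoidHom.mk' ((m - y) X) (hg X))
             naturality := fun X Y f => ?_ }⟩, fun X a => ?_⟩
  · ext a
    exact hg' X Y f a
  · have : m X a - (m - y) X a = y X a := by simp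
    exact this ▸ hmem X a

end Term

namespace Sub

variable {M : CMod C}

/-- A morphism which vanishes modulo `K` factors through `K`. -/
theorem exists_lift_of_comp_proj_eq_zero {A : CMod C} (K : Sub M) (g : A ⟶ M)
    (h : g ≫ K.proj = 0) : ∃ g' : A ⟶ K.toCMod, g' ≫ K.incl = g := by
  have hm : ∀ X a, (g.hom.app X).hom a ∈ K.carrier X := fun X a => by
    have := congrArg (fun φ : A ⟶ K.quotient => (φ.hom.app X).hom a) h
    exact (QuotientAddGroup.eq_zero_iff _).1 this
  refine ⟨⟨{ app := fun X => AddCommGrpCat.ofHom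
               ((g.hom.app X).hom.codRestrict (K.carrier X) (hm X))
             naturality := fun X Y f => ?_ }⟩, ?_⟩
  · ext a
    exact Subtype.ext (congrArg (fun φ => φ.hom a) (g.hom.naturality f))
  · ext X a
    rfl

theorem incl_injective {A : CMod C} (K : Sub M) {g g' : A ⟶ K.toCMod}
    (h : g ≫ K.incl = g' ≫ K.incl) : g = g' := by
  ext X a
  have := congrArg (fun φ : A ⟶ M => (φ.hom.app X).hom a) h
  exact Subtype.ext this

/-- Purity amounts to the lifting of morphisms `A ⟶ M/K` to `M`. -/
theorem isPure_of_exists_lift {𝒜 : Set (CMod C)} {K : Sub M}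
    (h : ∀ A ∈ 𝒜, ∀ φ : A ⟶ K.quotient, ∃ g : A ⟶ M, g ≫ K.proj = φ) : K.IsPure 𝒜 := by
  intro A hA
  refine ShortComplex.ShortExact.mk' ?_ ?_ ?_
  · rw [ShortComplex.ab_exact_iff]
    exact fun g hg => K.exists_lift_of_comp_proj_eq_zero g hg
  · rw [AddCommGrpCat.mono_iff_injective]
    exact fun g g' hg => K.incl_injective hg
  · rw [AddCommGrpCat.epi_iff_surjective]
    exact fun φ => h A hA φ

end Sub

/-- The submodules of differences of terms are pure. -/
theorem Term.isPure_diffSub {ι : Type u} {F : ι → CMod C} {X₀ : Cᵒᵖ} {M : CMod C}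
    (i j : M.obj.obj X₀) : (diffSub F i j).IsPure (Set.range F) := by
  refine Sub.isPure_of_exists_lift ?_
  rintro _ ⟨k, rfl⟩ φ
  let ψ (X : Cᵒᵖ) : (F k).obj.obj X →+ M.obj.obj X ⧸ (diffSub F i j).carrier X :=
    (φ.hom.app X).hom
  have hψ (X Y : Cᵒᵖ) (f : X ⟶ Y) (x : M.obj.obj X) (a : (F k).obj.obj X)
      (hx : QuotientAddGroup.mk x = ψ X a) :
      ψ Y (((F k).obj.map f).hom a) = QuotientAddGroup.mk ((M.obj.map f).hom x) :=
    (congrArg (fun χ => χ.hom a) (φ.hom.naturality f)).trans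
      (congrArg ((diffSub F i j).quotient.obj.map f).hom hx).symm
  choose m hm using fun X a => QuotientAddGroup.mk_surjective (ψ X a)
  obtain ⟨g, hg⟩ := exists_correction i j k m
    (fun X a b => by
      rw [← QuotientAddGroup.eq_zero_iff, QuotientAddGroup.mk_sub, QuotientAddGroup.mk_sub,
        hm, hm, hm, map_add, add_sub_cancel_left, sub_self])
    (fun X Y f a => by
      rw [← QuotientAddGroup.eq_zero_iff, QuotientAddGroup.mk_sub, hm, hψ X Y f _ a (hm X a),
        sub_self])
  refine ⟨g, ?_⟩
  ext X a
  have := (QuotientAddGroup.eq_zero_iff _).2 (hg X a)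
  rw [QuotientAddGroup.mk_sub, sub_eq_zero, hm] at this
  exact this.symm

/-- `X` is isomorphic to an object of the skeleton, whose value is a summand of `M.card`. -/
theorem mk_obj_le_card (M : CMod C) (X : Cᵒᵖ) : Cardinal.mk (M.obj.obj X) ≤ M.card := by
  let e : (fromSkeleton C).obj (toSkeleton X.unop) ≅ X.unop := fromSkeletonToSkeletonIso X.unop
  have h := Cardinal.mk_congr ((M.obj.mapIso e.op).addCommGroupIsoToAddEquiv.toEquiv)
  refine h.le.trans ?_
  exact Cardinal.le_sum (fun X : Skeleton C =>
    Cardinal.mk (M.obj.obj (op ((fromSkeleton C).obj X)))) (toSkeleton X.unop)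

/-- If `M(X₀)` is large compared with `M/L`, two distinct elements of `M(X₀)` have all their term
values congruent modulo `L`. -/
theorem Term.exists_ne_diffSub_le {ι : Type u} (F : ι → CMod C) {X₀ : Cᵒᵖ} {M : CMod C} (L : Sub M)
    {lam : Cardinal.{u}} (hL : L.quotient.card ≤ lam)
    (h : Cardinal.mk (∀ X, Term F X₀ X → lam.out) < Cardinal.mk (M.obj.obj X₀)) :
    ∃ i j : M.obj.obj X₀, i ≠ j ∧ diffSub F i j ≤ L := by
  have emb : ∀ X, Nonempty (M.obj.obj X ⧸ L.carrier X ↪ lam.out) := fun X => by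
    rw [← Cardinal.le_def, Cardinal.mk_out]
    exact (mk_obj_le_card L.quotient X).trans hL
  -- Record the classes modulo `L` of all term values, coded in a set independent of `M` and `L`.
  let c : M.obj.obj X₀ → ∀ X, Term F X₀ X → lam.out := fun i X t =>
    (emb X).some (QuotientAddGroup.mk (t.eval M i))
  have hc : ¬ Function.Injective c := fun hinj => (Cardinal.mk_le_of_injective hinj).not_gt h
  obtain ⟨i, j, hij, hne⟩ := Function.not_injective_iff.1 hc
  refine ⟨i, j, hne, ?_⟩
  rintro X _ ⟨t, rfl⟩
  have := (emb X).some.injective (congrFun (congrFun hij X) t)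
  rwa [← QuotientAddGroup.eq_zero_iff, QuotientAddGroup.mk_sub, sub_eq_zero]

end CMod

/-- "Set of modules" means a small set, hence `Small.{u}`; finite biproducts in `C` are not
required. -/
theorem theorem4p2 {C : Type u} [SmallCategory C] [Preadditive C]
    (𝒜 : Set (CMod C)) [Small.{u} 𝒜] (lam : Cardinal.{u}) :
    ∃ κ : Cardinal.{u}, ∀ (M : CMod C) (L : CMod.Sub M),
      κ ≤ M.card → L.quotient.card ≤ lam →
        ∃ K : CMod.Sub M, K ≤ L ∧ K ≠ ⊥ ∧ K.IsPure 𝒜 := by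
  let F : Shrink.{u} 𝒜 → CMod C := fun k => ((equivShrink 𝒜).symm k).1
  have hF : Set.range F = 𝒜 := by
    rw [show F = Subtype.val ∘ (equivShrink 𝒜).symm from rfl, EquivLike.range_comp,
      Subtype.range_coe]
  let θ : Skeleton C → Cardinal.{u} := fun Y =>
    Cardinal.mk (∀ X, CMod.Term F (op ((fromSkeleton C).obj Y)) X → lam.out)
  -- The successor forces some summand of `M.card` to exceed `θ` strictly, as the pigeonhole step
  -- needs.
  refine ⟨Order.succ (Cardinal.sum θ), fun M L hM hL => ?_⟩
  obtain ⟨Y, hY⟩ : ∃ Y, θ Y < Cardinal.mk (M.obj.obj (op ((fromSkeleton C).obj Y))) := by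
    by_contra! hle
    exact (Order.succ_le_iff.1 hM).not_ge (Cardinal.sum_le_sum _ _ hle)
  obtain ⟨i, j, hne, hle⟩ := CMod.Term.exists_ne_diffSub_le F L hL hY
  have hpure := CMod.Term.isPure_diffSub (F := F) i j
  rw [hF] at hpure
  exact ⟨_, hle, CMod.Term.diffSub_ne_bot hne, hpure⟩
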